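/- Let $n\ge 0$ be an integer, let $\hbar>0$, and write $z=(x,p)\in\mathbb R^{2n}=\mathbb R^n\times\mathbb R^n$, $\sigma(z,z')=p\cdot x'-p'\cdot x$, and $(f|g)=\int f\,\overline{g}$ for the scalar product of $L^2$. A density operator on a complex Hilbert space is a bounded operator that is positive semidefinite, of trace class, and has trace $1$. For $a\in L^2(\mathbb R^{2n})$ let $a_\sigma(z)=(2\pi\hbar)^{-n}\int e^{-\frac{i}{\hbar}\sigma(z,z')}a(z')\,dz'$ be its symplectic Fourier transform (extended to $L^2$ by continuity). A bounded operator $\widehat A$ on $L^2(\mathbb R^n)$ is the Weyl operator $\operatorname{Op}_{\mathrm{Weyl}}(a)$ with symbol $a$ if $$\widehat A\psi=(2\pi\hbar)^{-n}\int a_\sigma(z_0)\,\widehat T(z_0)\psi\,dz_0,\qquad \widehat T(z_0)\psi(x)=e^{\frac{i}{\hbar}(p_0\cdot x-\frac12 p_0\cdot x_0)}\psi(x-x_0),$$ the integral being understood weakly, i.e. $(\widehat A\psi|\chi)=(2\pi\hbar)^{-n}\int a_\sigma(z_0)(\widehat T(z_0)\psi|\chi)\,dz_0$ for all $\psi,\chi\in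 L^2(\mathbb R^n)$. The Bopp operator with symbol $a$ is $$\operatorname{Op}_{\mathrm{Bopp}}(a)\Psi(z)=(2\pi\hbar)^{-n}\int a_\sigma(z_0)\,e^{-\frac{i}{\hbar}\sigma(z,z_0)}\,\Psi(z-\tfrac12 z_0)\,dz_0,\qquad \Psi\in L^2(\mathbb R^{2n}).$$ For $\psi,\phi\in L^2(\mathbb R^n)$ put $$W(\psi,\phi)(x,p)=(2\pi\hbar)^{-n}\int e^{-\frac{i}{\hbar}p\cdot y}\psi(x+\tfrac12y)\overline{\phi(x-\tfrac12y)}\,dy,\qquad U_\phi\psi=(2\pi\hbar)^{n/2}W(\psi,\phi)\in L^2(\mathbb R^{2n}),$$ and $\mathcal H_\phi=\operatorname{Im}U_\phi\subset L^2(\mathbb R^{2n})$. For a vector $v$ of a Hilbert space, $\Pi_v$ denotes the orthogonal projection onto the line spanned by $v$. Proposition. Let $\widehat\rho$ be a density operator on $L^2(\mathbb R^n)$. Then there is $\rho\in L^2(\mathbb R^{2n})$ with $\widehat\rho=\operatorname{Op}_{\mathrm{Weyl}}((2\pi\hbar)^n\rho)$. For every such $\rho$, let $\widetilde\rho=\operatorname{Op}_{\mathrm{Bopp}}((2\pi\hbar)^n\rho)$.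 Then for every window $\phi\in L^2(\mathbb R^n)$, $\phi\ne0$: 1. $\mathcal H_\phi$ is a closed subspace of $L^2(\mathbb R^{2n})$, and $\widetilde\rho$ maps $\mathcal H_\phi$ into itself; its restriction $\widetilde\rho_\phi$ to $\mathcal H_\phi$ is a bounded operator on $\mathcal H_\phi$ and is a density operator on $\mathcal H_\phi$. 2. If $\widehat\rho=\sum_j\lambda_j\Pi_{\psi_j}$ with $\lambda_j\in\mathbb R$, $\psi_j\in L^2(\mathbb R^n)$ (unconditional convergence in operator norm), then, with $\Psi_j=U_\phi\psi_j$, also $\widetilde\rho_\phi=\sum_j\lambda_j\Pi_{\Psi_j}$ in the same sense, where $\Pi_{\Psi_j}$ is the orthogonal projection in $\mathcal H_\phi$. If moreover the $\psi_j$ are orthonormal, then $\widetilde\rho_\phi\Psi_j=\lambda_j\Psi_j$ for every $j$. -/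

import Mathlib

open MeasureTheory FourierTransform Filter
open scoped ENNReal ComplexConjugate

namespace BoppQuantization

section
variable {E : Type*} [NormedAddCommGroup E] [InnerProductSpace ℝ E] [FiniteDimensional ℝ E]
  [MeasurableSpace E] [BorelSpace E]

lemma fourier_toLp_ae_eq {f : E → ℂ} (h1 : Integrable f) (h2 : MemLp f 2) :
    (𝓕 (h2.toLp f) : Lp ℂ 2 (volume : Measure E)) =ᵐ[volume] 𝓕 f := by
  have hc : Continuous (𝓕 f) := VectorFourier.fourierIntegral_continuous
    Real.continuous_fourierChar (innerSL ℝ).continuous₂ h1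
  refine ae_eq_of_integral_contDiff_smul_eq ?_ hc.locallyIntegrable ?_
  · exact (Lp.memLp _).locallyIntegrable (by norm_num)
  intro g hg hgs
  have hs : HasCompactSupport (fun x => (g x : ℂ)) := hgs.comp_left (g := fun r : ℝ => (r : ℂ)) rfl
  have hd : ContDiff ℝ (⊤ : ℕ∞) (fun x => (g x : ℂ)) := Complex.ofRealCLM.contDiff.comp hg
  set G : SchwartzMap E ℂ := hs.toSchwartzMap hd with hG
  have hGx : ∀ x, G x = (g x : ℂ) := fun x => rfl
  have e1 := congrArg (fun T => T G) (Lp.fourier_toTemperedDistribution_eq (h2.toLp f))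
  simp only [TemperedDistribution.fourier_apply, Lp.toTemperedDistribution_apply] at e1
  have e2 : ∫ x, g x • (𝓕 (h2.toLp f) : Lp ℂ 2 (volume : Measure E)) x
      = ∫ x, G x • (𝓕 (h2.toLp f) : Lp ℂ 2 (volume : Measure E)) x := by
    simp [hGx]
  rw [e2, ← e1]
  have e3 : ∫ x, (𝓕 G) x • (h2.toLp f) x = ∫ x, (𝓕 G) x • f x := by
    apply integral_congr_ae
    filter_upwards [h2.coeFn_toLp] with x hx
    rw [hx]
  rw [e3]
  have e4 := VectorFourier.integral_fourierIntegral_smul_eq_flip (L := innerₗ E) (μ := volume)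
    (ν := volume) Real.continuous_fourierChar continuous_inner (G.integrable (μ := volume)) h1
  have hfl : (innerₗ E).flip = innerₗ E := by ext; simp
  rw [hfl] at e4
  calc _ = ∫ x, G x • 𝓕 f x := e4
    _ = _ := by simp [hGx]

lemma lintegral_fourier_sq {f : E → ℂ} (h1 : Integrable f) (h2 : MemLp f 2) :
    ∫⁻ w, ‖𝓕 f w‖ₑ ^ 2 = ∫⁻ y, ‖f y‖ₑ ^ 2 := by
  have key : ∀ g : E → ℂ, eLpNorm g 2 volume ^ 2 = ∫⁻ y, ‖g y‖ₑ ^ 2 := by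
    intro g
    rw [eLpNorm_eq_lintegral_rpow_enorm_toReal (by norm_num) (by norm_num)]
    simp only [ENNReal.toReal_ofNat, ENNReal.rpow_ofNat, one_div]
    rw [← ENNReal.rpow_natCast, ← ENNReal.rpow_mul]
    norm_num
  have e : eLpNorm (𝓕 f) 2 volume = eLpNorm f 2 volume := by
    rw [← eLpNorm_congr_ae (fourier_toLp_ae_eq h1 h2), ← eLpNorm_congr_ae h2.coeFn_toLp,
      ← Lp.enorm_def, ← Lp.enorm_def, enorm_eq_iff_norm_eq]
    exact Lp.norm_fourier_eq _
  rw [← key, ← key, e]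
end

/-- Configuration space `ℝⁿ`. -/
abbrev ConfigSpace (n : ℕ) : Type := EuclideanSpace ℝ (Fin n)

/-- Phase space `ℝ²ⁿ = ℝⁿ_x × ℝⁿ_p`; a point is `z = (x, p) = (z.fst, z.snd)`. -/
abbrev PhaseSpace (n : ℕ) : Type := WithLp 2 (ConfigSpace n × ConfigSpace n)

/-- `L²(X)` for Lebesgue measure. -/
abbrev L2 (X : Type) [MeasureSpace X] : Type := Lp ℂ 2 (volume : Measure X)


/-- The cross-Wigner transform `W(ψ, φ)`, evaluated at `z = (x, p)`:
`W(ψ, φ)(x, p) = (2πħ)⁻ⁿ ∫ exp(-(i/ħ) p·y) ψ(x + y/2) conj(φ(x - y/2)) dy`.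
For `ψ, φ ∈ L²` the integral converges absolutely for every `z`. -/
noncomputable def crossWigner {n : ℕ} (ħ : ℝ) (ψ φ : ConfigSpace n → ℂ) (z : PhaseSpace n) : ℂ :=
  ((1 / (2 * Real.pi * ħ)) ^ n : ℝ) *
    ∫ y : ConfigSpace n, Complex.exp (-(Complex.I / ħ) * (inner ℝ z.snd y : ℝ)) *
      (ψ (z.fst + (1 / 2 : ℝ) • y) * conj (φ (z.fst - (1 / 2 : ℝ) • y)))

lemma crossWigner_eq_fourier {n : ℕ} (ħ : ℝ) (ψ φ : ConfigSpace n → ℂ) (z : PhaseSpace n) :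
    crossWigner ħ ψ φ z = ((1 / (2 * Real.pi * ħ)) ^ n : ℝ) *
      𝓕 (fun y : ConfigSpace n => ψ (z.fst + (1 / 2 : ℝ) • y) *
        conj (φ (z.fst - (1 / 2 : ℝ) • y))) ((2 * Real.pi * ħ)⁻¹ • z.snd) := by
  rw [crossWigner, Real.fourier_eq']
  congr 2
  ext y
  rw [smul_eq_mul]
  congr 2
  rw [inner_smul_right, real_inner_comm]
  push_cast
  field_simp

lemma memLp_comp_half_add {n : ℕ} {f : ConfigSpace n → ℂ} (hf : MemLp f 2) (x : ConfigSpace n) {r : ℝ}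
    (hr : r ≠ 0) : MemLp (fun y => f (x + r • y)) 2 := by
  have h1 : MemLp (fun y => f (x + y)) 2 :=
    hf.comp_measurePreserving (measurePreserving_add_left volume x)
  have h2 : MemLp (fun y => f (x + y)) 2 (Measure.map (r • ·) (volume : Measure (ConfigSpace n))) := by
    rw [Measure.map_addHaar_smul _ hr]
    exact h1.smul_measure ENNReal.ofReal_ne_top
  exact (memLp_map_measure_iff h2.1 (by fun_prop)).1 h2

lemma integrable_crossWigner_kernel {n : ℕ} {f g : ConfigSpace n → ℂ} (hf : MemLp f 2) (hg : MemLp g 2)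
    (x : ConfigSpace n) :
    Integrable fun y => f (x + (1 / 2 : ℝ) • y) * conj (g (x - (1 / 2 : ℝ) • y)) := by
  have h1 := memLp_comp_half_add hf x (r := 1 / 2) (by norm_num)
  have h2 := memLp_comp_half_add hg x (r := -(1 / 2)) (by norm_num)
  have h3 : MemLp (fun y => conj (g (x + (-(1 / 2) : ℝ) • y))) 2 :=
    h2.star
  have := h1.integrable_mul h3
  simpa [neg_smul, ← sub_eq_add_neg] using! this

lemma lintegral_comp_smul_config {n : ℕ} (f : ConfigSpace n → ℝ≥0∞) (hf : Measurable f) {r : ℝ}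
    (hr : r ≠ 0) :
    ∫⁻ y, f (r • y) = ENNReal.ofReal |(r ^ n)⁻¹| * ∫⁻ y, f y := by
  have := lintegral_map (μ := (volume : Measure (ConfigSpace n))) hf (measurable_const_smul r)
  rw [← this, Measure.map_addHaar_smul _ hr, lintegral_smul_measure]
  simp

/-- `W(ψ, φ) ∈ L²(ℝ²ⁿ)` for `ψ, φ ∈ L²(ℝⁿ)`. -/
lemma memLp_crossWigner {n : ℕ} {ħ : ℝ} (hħ : 0 < ħ) (ψ φ : L2 (ConfigSpace n)) :
    MemLp (crossWigner ħ ψ φ) 2 (volume : Measure (PhaseSpace n)) := by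
  have mψ : StronglyMeasurable ψ := Lp.stronglyMeasurable ψ
  have mφ : StronglyMeasurable φ := Lp.stronglyMeasurable φ
  set k : ConfigSpace n → ConfigSpace n → ℂ := fun x y =>
    ψ (x + (1 / 2 : ℝ) • y) * conj (φ (x - (1 / 2 : ℝ) • y)) with hk
  have mk : StronglyMeasurable (Function.uncurry k) := by
    refine StronglyMeasurable.mul ?_ ?_
    · exact mψ.comp_measurable (by fun_prop)
    · exact Complex.continuous_conj.comp_stronglyMeasurable (mφ.comp_measurable (by fun_prop))
  have mW : StronglyMeasurable (crossWigner (n := n) ħ ψ φ) := by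
    unfold crossWigner
    refine StronglyMeasurable.const_mul ?_ _
    refine StronglyMeasurable.integral_prod_right' (f := fun q : PhaseSpace n × ConfigSpace n =>
      Complex.exp (-(Complex.I / ħ) * (inner ℝ q.1.snd q.2 : ℝ)) *
      (ψ (q.1.fst + (1 / 2 : ℝ) • q.2) * conj (φ (q.1.fst - (1 / 2 : ℝ) • q.2)))) ?_
    refine StronglyMeasurable.mul ?_ ?_
    · refine Continuous.stronglyMeasurable ?_
      fun_prop
    · have : Measurable fun q : PhaseSpace n × ConfigSpace n => (q.1.fst, q.2) := by
        refine Continuous.measurable ?_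
        fun_prop
      exact mk.comp_measurable this
  have h2k : ∫⁻ x, ∫⁻ y, ‖k x y‖ₑ ^ 2 < ∞ := by
    have mk2 : Measurable (Function.uncurry fun x y => ‖k x y‖ₑ ^ 2) :=
      (mk.enorm.pow_const 2)
    have fin : ∀ f : L2 (ConfigSpace n), ∫⁻ y, ‖f y‖ₑ ^ 2 < ∞ := by
      intro f
      have := (Lp.memLp f).2
      rw [eLpNorm_lt_top_iff_lintegral_rpow_enorm_lt_top (by norm_num) (by norm_num)] at this
      simpa using this
    rw [lintegral_lintegral_swap mk2.aemeasurable]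
    have e : ∀ y, ∫⁻ x, ‖k x y‖ₑ ^ 2 = ∫⁻ x, ‖ψ x‖ₑ ^ 2 * ‖φ (x - y)‖ₑ ^ 2 := by
      intro y
      rw [← lintegral_add_right_eq_self (μ := volume) (fun x => ‖ψ x‖ₑ ^ 2 * ‖φ (x - y)‖ₑ ^ 2)
        ((1 / 2 : ℝ) • y)]
      refine lintegral_congr fun x => ?_
      have : x + (1 / 2 : ℝ) • y - y = x - (1 / 2 : ℝ) • y := by
        module
      rw [this, hk]
      simp [enorm_mul, mul_pow]
    simp_rw [e]
    have m1 : Measurable fun x => ‖ψ x‖ₑ ^ 2 := mψ.enorm.pow_const 2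
    have m2 : Measurable fun x => ‖φ x‖ₑ ^ 2 := mφ.enorm.pow_const 2
    rw [lintegral_lintegral_swap]
    · have e3 : ∀ x, ∫⁻ y, ‖ψ x‖ₑ ^ 2 * ‖φ (x - y)‖ₑ ^ 2
          = ‖ψ x‖ₑ ^ 2 * ∫⁻ y, ‖φ y‖ₑ ^ 2 := by
        intro x
        rw [lintegral_const_mul' _ _ (by simp),
          lintegral_sub_left_eq_self (fun y => ‖φ y‖ₑ ^ 2)]
      simp_rw [e3]
      rw [lintegral_mul_const _ m1]
      exact ENNReal.mul_lt_top (fin ψ) (fin φ)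
    · refine Measurable.aemeasurable ?_
      exact (m1.comp measurable_snd).mul (m2.comp (by fun_prop))
  have hae : ∀ᵐ x, MemLp (k x) 2 := by
    have mm : Measurable fun x => ∫⁻ y, ‖k x y‖ₑ ^ 2 :=
      Measurable.lintegral_prod_right' (f := fun q : ConfigSpace n × ConfigSpace n =>
        ‖k q.1 q.2‖ₑ ^ 2) (mk.enorm.pow_const 2)
    filter_upwards [ae_lt_top mm h2k.ne] with x hx
    refine ⟨(mk.comp_measurable (measurable_prodMk_left (x := x))).aestronglyMeasurable, ?_⟩
    rw [eLpNorm_lt_top_iff_lintegral_rpow_enorm_lt_top (by norm_num) (by norm_num)]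
    simpa using hx
  refine ⟨mW.aestronglyMeasurable, ?_⟩
  rw [eLpNorm_lt_top_iff_lintegral_rpow_enorm_lt_top (by norm_num) (by norm_num)]
  simp only [ENNReal.toReal_ofNat, ENNReal.rpow_ofNat]
  have mW2 : Measurable fun z => ‖crossWigner (n := n) ħ ψ φ z‖ₑ ^ 2 := mW.enorm.pow_const 2
  rw [← (WithLp.volume_preserving_toLp (ConfigSpace n) (ConfigSpace n)).lintegral_comp mW2,
    Measure.volume_eq_prod, lintegral_prod _ (by
      refine Measurable.aemeasurable ?_
      exact mW2.comp (WithLp.measurable_toLp 2 _))]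
  have hc : (2 * Real.pi * ħ)⁻¹ ≠ 0 := by positivity
  set A : ℝ≥0∞ := ‖(((1 / (2 * Real.pi * ħ)) ^ n : ℝ) : ℂ)‖ₑ ^ 2
  set B : ℝ≥0∞ := ENNReal.ofReal |((2 * Real.pi * ħ)⁻¹ ^ n)⁻¹|
  have hA : A ≠ ∞ := ENNReal.pow_ne_top enorm_ne_top
  have hin : ∀ᵐ x : ConfigSpace n, ∫⁻ p : ConfigSpace n,
      ‖crossWigner (n := n) ħ ψ φ (WithLp.toLp 2 (x, p))‖ₑ ^ 2 =
      A * (B * ∫⁻ y, ‖k x y‖ₑ ^ 2) := by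
    filter_upwards [hae] with x hx
    have hI : Integrable (k x) := integrable_crossWigner_kernel (Lp.memLp ψ) (Lp.memLp φ) x
    have hcont : Continuous (𝓕 (k x)) := VectorFourier.fourierIntegral_continuous
      Real.continuous_fourierChar (innerSL ℝ).continuous₂ hI
    rw [← lintegral_fourier_sq hI hx,
      ← lintegral_comp_smul_config (fun w => ‖𝓕 (k x) w‖ₑ ^ 2)
        (hcont.measurable.enorm.pow_const 2) hc,
      ← lintegral_const_mul' _ _ hA]
    refine lintegral_congr fun p => ?_
    rw [crossWigner_eq_fourier, enorm_mul, mul_pow]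
    rfl
  rw [lintegral_congr_ae hin, lintegral_const_mul' _ _ hA,
    lintegral_const_mul' _ _ ENNReal.ofReal_ne_top]
  exact ENNReal.mul_lt_top hA.lt_top (ENNReal.mul_lt_top ENNReal.ofReal_lt_top h2k)

lemma quasiMeasurePreserving_half_add {n : ℕ} (x : ConfigSpace n) :
    Measure.QuasiMeasurePreserving (fun y : ConfigSpace n => x + (1 / 2 : ℝ) • y) :=
  (measurePreserving_add_left volume x).quasiMeasurePreserving.comp
    (Measure.quasiMeasurePreserving_smul (volume : Measure (ConfigSpace n)) (by norm_num))

lemma crossWigner_add {n : ℕ} (ħ : ℝ) (ψ₁ ψ₂ φ : L2 (ConfigSpace n)) :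
    crossWigner ħ (ψ₁ + ψ₂ : L2 (ConfigSpace n)) φ =
      crossWigner ħ ψ₁ φ + crossWigner ħ ψ₂ φ := by
  funext z
  have hexp : ∀ f : ConfigSpace n → ℂ, Integrable f → Integrable fun y =>
      Complex.exp (-(Complex.I / ħ) * (inner ℝ z.snd y : ℝ)) * f y := by
    intro f hf
    refine hf.bdd_mul (c := 1) (Continuous.aestronglyMeasurable (by fun_prop)) ?_
    refine Filter.Eventually.of_forall fun y => ?_
    have : -(Complex.I / ħ) * (inner ℝ z.snd y : ℝ) =
        ((-(inner ℝ z.snd y) / ħ : ℝ) : ℂ) * Complex.I := by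
      push_cast
      ring
    rw [this, Complex.norm_exp_ofReal_mul_I]
  rw [Pi.add_apply, crossWigner, crossWigner, crossWigner, ← mul_add, ← integral_add
    (hexp _ (integrable_crossWigner_kernel (Lp.memLp ψ₁) (Lp.memLp φ) z.fst))
    (hexp _ (integrable_crossWigner_kernel (Lp.memLp ψ₂) (Lp.memLp φ) z.fst))]
  congr 1
  refine integral_congr_ae ?_
  filter_upwards [(quasiMeasurePreserving_half_add z.fst).ae (Lp.coeFn_add ψ₁ ψ₂)] with y hy
  simp only [hy, Pi.add_apply, add_mul, mul_add]

lemma crossWigner_smul {n : ℕ} (ħ : ℝ) (c : ℂ) (ψ φ : L2 (ConfigSpace n)) :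
    crossWigner ħ (c • ψ : L2 (ConfigSpace n)) φ = c • crossWigner ħ ψ φ := by
  funext z
  rw [Pi.smul_apply, crossWigner, crossWigner, smul_eq_mul, mul_left_comm,
    ← integral_const_mul c]
  congr 1
  refine integral_congr_ae ?_
  filter_upwards [(quasiMeasurePreserving_half_add z.fst).ae (Lp.coeFn_smul c ψ)] with y hy
  simp only [hy, Pi.smul_apply, smul_eq_mul]
  ring

/-- The wavepacket transform `U_φ ψ = (2πħ)^(n/2) W(ψ, φ)` with window `φ`, as a linear map
`L²(ℝⁿ) → L²(ℝ²ⁿ)`. -/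
noncomputable def wavepacket {n : ℕ} {ħ : ℝ} (hħ : 0 < ħ) (φ : L2 (ConfigSpace n)) :
    L2 (ConfigSpace n) →ₗ[ℂ] L2 (PhaseSpace n) where
  toFun ψ := (((2 * Real.pi * ħ) ^ ((n : ℝ) / 2) : ℝ) : ℂ) • (memLp_crossWigner hħ ψ φ).toLp
  map_add' ψ₁ ψ₂ := by
    rw [← smul_add, ← MemLp.toLp_add]
    congr 1
    exact MemLp.toLp_congr _ _ (Eq.eventuallyEq (crossWigner_add ħ ψ₁ ψ₂ φ))
  map_smul' c ψ := by
    rw [RingHom.id_apply, smul_comm c]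
    refine congrArg _ ?_
    rw [← MemLp.toLp_const_smul]
    exact MemLp.toLp_congr _ _ (Eq.eventuallyEq (crossWigner_smul ħ c ψ φ))

/-- The subspace `H_φ = Im U_φ` of `L²(ℝ²ⁿ)`. -/
noncomputable def windowSpace {n : ℕ} {ħ : ℝ} (hħ : 0 < ħ) (φ : L2 (ConfigSpace n)) :
    Submodule ℂ (L2 (PhaseSpace n)) :=
  LinearMap.range (wavepacket hħ φ)

/-- `U_φ ψ`, regarded as an element of `H_φ`. -/
noncomputable def wavepacketIn {n : ℕ} {ħ : ℝ} (hħ : 0 < ħ) (φ ψ : L2 (ConfigSpace n)) :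
    windowSpace hħ φ :=
  ⟨wavepacket hħ φ ψ, LinearMap.mem_range_self _ ψ⟩

/-! ### Weyl and Bopp operators -/

/-- `J z = (p, -x)` for `z = (x, p)`. -/
noncomputable def symplecticJ {n : ℕ} (z : PhaseSpace n) : PhaseSpace n :=
  WithLp.toLp 2 (z.snd, -z.fst)

/-- The standard symplectic form `σ(z, z') = J z · z' = p·x' - x·p'`. -/
noncomputable def symplecticForm {n : ℕ} (z z' : PhaseSpace n) : ℝ :=
  inner ℝ (symplecticJ z) z'

/-- The symplectic Fourier transform `a_σ = F_σ a` of `a ∈ L²(ℝ²ⁿ)`, that is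
`F_σ a(z) = (2πħ)⁻ⁿ ∫ exp(-(i/ħ) σ(z, z')) a(z') dz'`, extended to `L²`: it is the `L²`-Fourier
transform (normalized with the kernel `exp(-2πi v·w)`) at the frequency `w = (2πħ)⁻¹ J z`. -/
noncomputable def symplecticFourier {n : ℕ} (ħ : ℝ) (a : L2 (PhaseSpace n)) (z : PhaseSpace n) :
    ℂ :=
  ((1 / (2 * Real.pi * ħ)) ^ n : ℝ) *
    (𝓕 a : L2 (PhaseSpace n)) ((2 * Real.pi * ħ)⁻¹ • symplecticJ z)

/-- The frequency in `symplecticFourier` is the one that gives the kernel `exp(-(i/ħ) σ(z, z'))`. -/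
lemma fourier_symplecticJ {n : ℕ} (ħ : ℝ) (f : PhaseSpace n → ℂ) (z : PhaseSpace n) :
    𝓕 f ((2 * Real.pi * ħ)⁻¹ • symplecticJ z) =
      ∫ z', Complex.exp (-(Complex.I / ħ) * (symplecticForm z z' : ℝ)) * f z' := by
  rw [Real.fourier_eq']
  congr 1
  ext y
  rw [smul_eq_mul, inner_smul_right, symplecticForm, real_inner_comm]
  congr 2
  push_cast
  field_simp

/-- The Heisenberg–Weyl displacement operator
`T̂(z₀)ψ(x) = exp((i/ħ)(p₀·x - p₀·x₀/2)) ψ(x - x₀)`, `z₀ = (x₀, p₀)`. -/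
noncomputable def heisenbergWeyl {n : ℕ} (ħ : ℝ) (z₀ : PhaseSpace n) (ψ : ConfigSpace n → ℂ)
    (x : ConfigSpace n) : ℂ :=
  Complex.exp ((Complex.I / ħ) *
      ((inner ℝ z₀.snd x - (1 / 2) * inner ℝ z₀.snd z₀.fst : ℝ) : ℂ)) *
    ψ (x - z₀.fst)

/-- `A = Op_Weyl(a)`, for a bounded operator `A` on `L²(ℝⁿ)` and a symbol `a ∈ L²(ℝ²ⁿ)`: the
harmonic representation `A ψ = (2πħ)⁻ⁿ ∫ a_σ(z) T̂(z)ψ dz` holds as a weak vector-valued integral,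
i.e. after taking the scalar product with any `χ ∈ L²(ℝⁿ)`. (Both factors of the integrand in `z`
are square integrable, so the integral converges absolutely.) -/
def IsWeylOperator {n : ℕ} (ħ : ℝ) (a : L2 (PhaseSpace n))
    (A : L2 (ConfigSpace n) →L[ℂ] L2 (ConfigSpace n)) : Prop :=
  ∀ ψ χ : L2 (ConfigSpace n),
    inner ℂ χ (A ψ) = ((1 / (2 * Real.pi * ħ)) ^ n : ℝ) *
      ∫ z : PhaseSpace n, symplecticFourier ħ a z *
        ∫ x : ConfigSpace n, heisenbergWeyl ħ z ψ x * conj (χ x)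

/-- The Bopp displacement operator `T̃(z₀)Ψ(z) = exp(-(i/ħ) σ(z, z₀)) Ψ(z - z₀/2)`. -/
noncomputable def boppDisplacement {n : ℕ} (ħ : ℝ) (z₀ : PhaseSpace n) (Ψ : PhaseSpace n → ℂ)
    (z : PhaseSpace n) : ℂ :=
  Complex.exp (-(Complex.I / ħ) * (symplecticForm z z₀ : ℝ)) * Ψ (z - (1 / 2 : ℝ) • z₀)

/-- The Bopp operator `Op_Bopp(a)` with symbol `a ∈ L²(ℝ²ⁿ)`:
`Op_Bopp(a)Ψ(z) = (a ⋆ Ψ)(z) = (2πħ)⁻ⁿ ∫ a_σ(z₀) T̃(z₀)Ψ(z) dz₀`.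
For `a, Ψ ∈ L²(ℝ²ⁿ)` the integral converges absolutely for every `z`, and depends only on the
classes of `a` and `Ψ`, so that no extension from Schwartz functions is needed. -/
noncomputable def boppOperator {n : ℕ} (ħ : ℝ) (a : L2 (PhaseSpace n)) (Ψ : PhaseSpace n → ℂ)
    (z : PhaseSpace n) : ℂ :=
  ((1 / (2 * Real.pi * ħ)) ^ n : ℝ) *
    ∫ z₀ : PhaseSpace n, symplecticFourier ħ a z₀ * boppDisplacement ħ z₀ Ψ z

/-! ### Density operators -/

/-- A bounded operator `T` on a complex Hilbert space is of trace class iff `∑ |⟨T e_i, e_i⟩|` is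
finite for every orthonormal basis `(e_i)`. -/
def IsTraceClass {H : Type} [NormedAddCommGroup H] [InnerProductSpace ℂ H] (T : H →L[ℂ] H) :
    Prop :=
  ∀ (ι : Type) (e : HilbertBasis ι ℂ H), Summable fun i => ‖inner ℂ (e i) (T (e i))‖

/-- `T` has trace `t`: `∑ ⟨T e_i, e_i⟩ = t` for every orthonormal basis `(e_i)`. -/
def HasTrace {H : Type} [NormedAddCommGroup H] [InnerProductSpace ℂ H] (T : H →L[ℂ] H) (t : ℂ) :
    Prop :=
  ∀ (ι : Type) (e : HilbertBasis ι ℂ H), HasSum (fun i => inner ℂ (e i) (T (e i))) t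

/-- A density operator on a Hilbert space: positive semidefinite, of trace class, with trace `1`. -/
structure IsDensityOperator {H : Type} [NormedAddCommGroup H] [InnerProductSpace ℂ H]
    (T : H →L[ℂ] H) : Prop where
  isPositive : T.IsPositive
  isTraceClass : IsTraceClass T
  hasTrace_one : HasTrace T 1

/-- The orthogonal projection `Π_v` of a Hilbert space onto the ray `ℂ v` (for a unit vector `v`,
`Π_v u = (u|v) v`). -/
noncomputable def rayProjection {H : Type} [NormedAddCommGroup H] [InnerProductSpace ℂ H] (v : H) :
    H →L[ℂ] H :=
  (Submodule.span ℂ {v}).starProjection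

end BoppQuantization

open BoppQuantization

/-! Everything about the Bopp operator follows from unitary equivalence with the given density
operator. Moyal's identity (`inner_wavepacket`) gives `‖U_φ ψ‖ = ‖φ‖ ‖ψ‖`, so for `φ ≠ 0` the map
`‖φ‖⁻¹ U_φ` is unitary from `L²(ℝⁿ)` onto `H_φ`. In particular `H_φ` is complete, hence closed.

The map `U_φ` intertwines the Weyl and Bopp operators with the same symbol. On displacements this is
a change of variable in the Wigner integral (`crossWigner_heisenbergWeyl`). It passes to
superpositions because the value of `W(ψ, φ)` at a point `z` is, up to a constant, the scalar
product of `ψ` with the reflection of `φ` about `z`, and the weak definition of the Weyl operator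
may be tested on that vector (`crossWigner_weylOperator`). Thus the Bopp operator restricted to
`H_φ` is a unitary conjugate of the Weyl operator. Positivity, trace and norm-convergent sums of ray
projections are carried along, and rescaling `U_φ` does not change the rays.

For the existence of a symbol, a positive trace class operator `A` is Hilbert–Schmidt. With `P` the
parity and `e_i` a Hilbert basis, the vectors `U_{P e_i}(A e_i)` are mutually orthogonal with square
summable norms, so they sum to some `F ∈ L²(ℝ²ⁿ)`, and Moyal's identity gives `(Aψ|χ) = (F|U_{Pψ}
χ)`. Since a matrix element of `T̂(z)` is a conjugated Wigner function at `z/2`, a dilated multiple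
of `F` serves as `a_σ`, and Fourier inversion yields `a`. -/

namespace BoppQuantization

/-! ### Plancherel and Moyal identities -/

/-- Plancherel's identity on `L¹ ∩ L²`. -/
lemma integral_fourier_mul_conj_fourier {E : Type*} [NormedAddCommGroup E] [InnerProductSpace ℝ E]
    [FiniteDimensional ℝ E] [MeasurableSpace E] [BorelSpace E] {f g : E → ℂ}
    (f1 : Integrable f) (f2 : MemLp f 2) (g1 : Integrable g) (g2 : MemLp g 2) :
    ∫ w, 𝓕 f w * conj (𝓕 g w) = ∫ y, f y * conj (g y) := by
  have h := Lp.inner_fourier_eq (g2.toLp g) (f2.toLp f)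
  rw [L2.inner_def, L2.inner_def] at h
  calc _ = ∫ w, inner ℂ ((𝓕 (g2.toLp g) : Lp ℂ 2 (volume : Measure E)) w)
        ((𝓕 (f2.toLp f) : Lp ℂ 2 (volume : Measure E)) w) := by
        refine integral_congr_ae ?_
        filter_upwards [fourier_toLp_ae_eq f1 f2, fourier_toLp_ae_eq g1 g2] with w h1 h2
        rw [h1, h2, RCLike.inner_apply]
    _ = _ := h
    _ = _ := by
        refine integral_congr_ae ?_
        filter_upwards [f2.coeFn_toLp, g2.coeFn_toLp] with w h1 h2
        rw [h1, h2, RCLike.inner_apply]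

variable {n : ℕ}

/-- The change of variables `(x, y) ↦ (x + y/2, x - y/2)` preserves the Lebesgue measure. -/
lemma measurePreserving_halfSumDiff :
    MeasurePreserving (fun q : ConfigSpace n × ConfigSpace n =>
      (q.1 + (1 / 2 : ℝ) • q.2, q.1 - (1 / 2 : ℝ) • q.2)) (volume.prod volume)
      (volume.prod volume) := by
  have h1 : MeasurePreserving (fun q : ConfigSpace n × ConfigSpace n =>
      (q.1, q.2 + (1 / 2 : ℝ) • q.1)) (volume.prod volume) (volume.prod volume) :=
    (MeasurePreserving.id volume).skew_product (g := fun y x => x + (1 / 2 : ℝ) • y)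
      (by fun_prop) (ae_of_all _ fun y => (measurePreserving_add_right volume _).map_eq)
  have h2 : MeasurePreserving (fun q : ConfigSpace n × ConfigSpace n =>
      (q.1, q.1 - q.2)) (volume.prod volume) (volume.prod volume) :=
    (MeasurePreserving.id volume).skew_product (g := fun u y => u - y)
      (by fun_prop) (ae_of_all _ fun u => (Measure.measurePreserving_sub_left volume u).map_eq)
  -- Shear to `(x + y/2, y)`, then replace the second entry by the difference `x + y/2 - y = x -
  -- y/2`.
  have h3 := h2.comp (Measure.measurePreserving_swap.comp
    (h1.comp Measure.measurePreserving_swap))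
  convert! h3 using 1
  funext q
  simp only [Function.comp, Prod.swap, Prod.mk.injEq, true_and]
  module

lemma integrable_mul_halfSumDiff {u v : ConfigSpace n → ℂ} (hu : Integrable u)
    (hv : Integrable v) :
    Integrable (fun q : ConfigSpace n × ConfigSpace n =>
      u (q.1 + (1 / 2 : ℝ) • q.2) * v (q.1 - (1 / 2 : ℝ) • q.2)) (volume.prod volume) :=
  measurePreserving_halfSumDiff.integrable_comp_of_integrable (hu.mul_prod hv)

lemma integral_mul_halfSumDiff {u v : ConfigSpace n → ℂ} (hu : Integrable u)
    (hv : Integrable v) :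
    ∫ x, ∫ y, u (x + (1 / 2 : ℝ) • y) * v (x - (1 / 2 : ℝ) • y) = (∫ x, u x) * ∫ y, v y := by
  rw [← integral_prod_mul, ← measurePreserving_halfSumDiff.map_eq, integral_map
    measurePreserving_halfSumDiff.measurable.aemeasurable,
    integral_prod _ (integrable_mul_halfSumDiff hu hv)]
  rw [measurePreserving_halfSumDiff.map_eq]
  exact (hu.mul_prod hv).aestronglyMeasurable

/-- By Fubini, almost every slice of the sheared tensor product `|ψ|² ⊗ |φ|²` is integrable.
Plancherel in `y` needs the kernel in `L¹ ∩ L²`: the first holds for every `x`, the second is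
obtained here for almost every `x`. -/
lemma ae_memLp_crossWigner_kernel (ψ φ : L2 (ConfigSpace n)) :
    ∀ᵐ x : ConfigSpace n, MemLp (fun y => ψ (x + (1 / 2 : ℝ) • y) *
      conj (φ (x - (1 / 2 : ℝ) • y))) 2 := by
  have sq : ∀ f : L2 (ConfigSpace n), Integrable fun x => ((‖f x‖ ^ 2 : ℝ) : ℂ) := fun f =>
    ((memLp_two_iff_integrable_sq_norm (Lp.memLp f).1).1 (Lp.memLp f)).ofReal
  filter_upwards [(integrable_mul_halfSumDiff (sq ψ) (sq φ)).prod_right_ae] with x hx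
  refine (memLp_two_iff_integrable_sq_norm
    (integrable_crossWigner_kernel (Lp.memLp ψ) (Lp.memLp φ) x).1).2 ?_
  refine hx.norm.congr (ae_of_all _ fun y => ?_)
  simp [mul_pow]

/-- **Moyal's identity**. -/
lemma integral_crossWigner_mul_conj {ħ : ℝ} (hħ : 0 < ħ) (ψ₁ φ₁ ψ₂ φ₂ : L2 (ConfigSpace n)) :
    ∫ z : PhaseSpace n, crossWigner ħ ψ₁ φ₁ z * conj (crossWigner ħ ψ₂ φ₂ z) =
      (((2 * Real.pi * ħ) ^ n : ℝ) : ℂ)⁻¹ * (inner ℂ ψ₂ ψ₁ * inner ℂ φ₁ φ₂) := by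
  have hint : Integrable fun z : PhaseSpace n =>
      crossWigner ħ ψ₁ φ₁ z * conj (crossWigner ħ ψ₂ φ₂ z) :=
    (memLp_crossWigner hħ ψ₁ φ₁).integrable_mul (memLp_crossWigner hħ ψ₂ φ₂).star
  have hmp := WithLp.volume_preserving_toLp (ConfigSpace n) (ConfigSpace n)
  have hemb : MeasurableEmbedding (WithLp.toLp 2 : ConfigSpace n × ConfigSpace n → PhaseSpace n) :=
    (MeasurableEquiv.toLp 2 (ConfigSpace n × ConfigSpace n)).measurableEmbedding
  have hint2 := hmp.integrable_comp_of_integrable hint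
  rw [← hmp.integral_comp hemb]
  refine (integral_prod _ hint2).trans ?_
  have hin : ∀ᵐ x : ConfigSpace n, ∫ p : ConfigSpace n,
      crossWigner ħ ψ₁ φ₁ (WithLp.toLp 2 (x, p)) * conj (crossWigner ħ ψ₂ φ₂ (WithLp.toLp 2 (x, p)))
      = (((2 * Real.pi * ħ) ^ n : ℝ) : ℂ)⁻¹ * ∫ y,
        (ψ₁ (x + (1 / 2 : ℝ) • y) * conj (ψ₂ (x + (1 / 2 : ℝ) • y))) *
        (φ₂ (x - (1 / 2 : ℝ) • y) * conj (φ₁ (x - (1 / 2 : ℝ) • y))) := by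
    filter_upwards [ae_memLp_crossWigner_kernel ψ₁ φ₁, ae_memLp_crossWigner_kernel ψ₂ φ₂]
      with x h1 h2
    have P := integral_fourier_mul_conj_fourier
      (integrable_crossWigner_kernel (Lp.memLp ψ₁) (Lp.memLp φ₁) x) h1
      (integrable_crossWigner_kernel (Lp.memLp ψ₂) (Lp.memLp φ₂) x) h2
    -- Substituting `p = 2πħ w` produces the Jacobian `(2πħ)ⁿ`. Against the squared prefactor
    -- `(2πħ)⁻²ⁿ` it leaves the single factor `(2πħ)⁻ⁿ`.
    have S := Measure.integral_comp_smul (volume : Measure (ConfigSpace n)) (fun w =>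
      𝓕 (fun y : ConfigSpace n => ψ₁ (x + (1 / 2 : ℝ) • y) * conj (φ₁ (x - (1 / 2 : ℝ) • y))) w *
      conj (𝓕 (fun y : ConfigSpace n => ψ₂ (x + (1 / 2 : ℝ) • y) *
        conj (φ₂ (x - (1 / 2 : ℝ) • y))) w)) (2 * Real.pi * ħ)⁻¹
    rw [P] at S
    simp only [crossWigner_eq_fourier]
    have e : ∀ a b c d : ℂ, a * b * conj (c * d) = (a * conj c) * (b * conj d) := by
      intro a b c d
      rw [map_mul]
      ring
    simp only [e]
    rw [integral_const_mul]
    refine (congrArg _ S).trans ?_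
    rw [finrank_euclideanSpace, Fintype.card_fin, abs_of_nonneg (by positivity),
      Complex.real_smul, ← mul_assoc]
    congr 1
    · rw [Complex.conj_ofReal]
      push_cast
      have : (2 * Real.pi * ħ : ℂ) ≠ 0 := by exact_mod_cast (by positivity : (2 * Real.pi * ħ) ≠ 0)
      rw [one_div, inv_pow, inv_inv]
      field_simp
    · refine integral_congr_ae (ae_of_all _ fun y => ?_)
      simp only [map_mul, Complex.conj_conj]
      ring
  have hi : ∀ f g : L2 (ConfigSpace n), Integrable fun x => f x * conj (g x) := fun f g =>
    (Lp.memLp f).integrable_mul (Lp.memLp g).star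
  refine (integral_congr_ae hin).trans ?_
  rw [integral_const_mul, integral_mul_halfSumDiff (hi ψ₁ ψ₂) (hi φ₂ φ₁), L2.inner_def,
    L2.inner_def]
  rfl

lemma wavepacket_coeFn {ħ : ℝ} (hħ : 0 < ħ) (φ ψ : L2 (ConfigSpace n)) :
    (wavepacket hħ φ ψ : PhaseSpace n → ℂ) =ᵐ[volume] fun z =>
      (((2 * Real.pi * ħ) ^ ((n : ℝ) / 2) : ℝ) : ℂ) * crossWigner ħ ψ φ z := by
  filter_upwards [Lp.coeFn_smul (((2 * Real.pi * ħ) ^ ((n : ℝ) / 2) : ℝ) : ℂ)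
    (memLp_crossWigner hħ ψ φ).toLp, (memLp_crossWigner hħ ψ φ).coeFn_toLp] with z h1 h2
  refine h1.trans ?_
  rw [Pi.smul_apply, h2, smul_eq_mul]

/-- Moyal's identity for wavepacket transforms. -/
lemma inner_wavepacket {ħ : ℝ} (hħ : 0 < ħ) (φ₁ φ₂ ψ₁ ψ₂ : L2 (ConfigSpace n)) :
    inner ℂ (wavepacket hħ φ₁ ψ₁) (wavepacket hħ φ₂ ψ₂) = inner ℂ ψ₁ ψ₂ * inner ℂ φ₂ φ₁ := by
  have h0 : 0 < 2 * Real.pi * ħ := by positivity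
  have hc : (((2 * Real.pi * ħ) ^ ((n : ℝ) / 2) : ℝ) : ℂ) *
      (((2 * Real.pi * ħ) ^ ((n : ℝ) / 2) : ℝ) : ℂ) = (((2 * Real.pi * ħ) ^ n : ℝ) : ℂ) := by
    rw [← Complex.ofReal_mul, ← Real.rpow_add h0, add_halves, Real.rpow_natCast]
  have hne : (((2 * Real.pi * ħ) ^ n : ℝ) : ℂ) ≠ 0 := by exact_mod_cast (pow_pos h0 n).ne'
  rw [L2.inner_def]
  calc _ = ∫ z : PhaseSpace n, (((2 * Real.pi * ħ) ^ n : ℝ) : ℂ) *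
        (crossWigner ħ ψ₂ φ₂ z * conj (crossWigner ħ ψ₁ φ₁ z)) := by
        refine integral_congr_ae ?_
        filter_upwards [wavepacket_coeFn hħ φ₁ ψ₁, wavepacket_coeFn hħ φ₂ ψ₂] with z h1 h2
        rw [h1, h2, RCLike.inner_apply, map_mul, Complex.conj_ofReal, ← hc]
        ring
    _ = _ := by
        rw [integral_const_mul, integral_crossWigner_mul_conj hħ, ← mul_assoc,
          mul_inv_cancel₀ hne, one_mul]

/-! ### Phase space reflections and the intertwining relation -/

/-- Substitute `u = x + y/2`. The Jacobian `2ⁿ` turns `(2πħ)⁻ⁿ` into `(πħ)⁻ⁿ`, and `ψ` now appears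
undisplaced, as a scalar product requires. -/
lemma crossWigner_eq_integral_reflect {ħ : ℝ} (ψ φ : ConfigSpace n → ℂ)
    (z : PhaseSpace n) :
    crossWigner ħ ψ φ z = ((1 / (Real.pi * ħ)) ^ n : ℝ) *
      ∫ u : ConfigSpace n, Complex.exp (-(Complex.I / ħ) *
        ((2 * inner ℝ z.snd (u - z.fst) : ℝ) : ℂ)) *
        (ψ u * conj (φ ((2 : ℝ) • z.fst - u))) := by
  set G : ConfigSpace n → ℂ := fun y => Complex.exp (-(Complex.I / ħ) * (inner ℝ z.snd y : ℝ)) *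
      (ψ (z.fst + (1 / 2 : ℝ) • y) * conj (φ (z.fst - (1 / 2 : ℝ) • y))) with hG
  have h1 : ∫ u, G ((2 : ℝ) • (u - z.fst)) = |((2 : ℝ) ^ n)⁻¹| • ∫ y, G y := by
    rw [integral_sub_right_eq_self (fun u => G ((2 : ℝ) • u)), Measure.integral_comp_smul,
      finrank_euclideanSpace, Fintype.card_fin]
  have h2 : ∀ u, G ((2 : ℝ) • (u - z.fst)) = Complex.exp (-(Complex.I / ħ) *
        ((2 * inner ℝ z.snd (u - z.fst) : ℝ) : ℂ)) *
        (ψ u * conj (φ ((2 : ℝ) • z.fst - u))) := by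
    intro u
    have e1 : z.fst + (1 / 2 : ℝ) • (2 : ℝ) • (u - z.fst) = u := by module
    have e2 : z.fst - (1 / 2 : ℝ) • (2 : ℝ) • (u - z.fst) = (2 : ℝ) • z.fst - u := by module
    simp only [hG, e1, e2, real_inner_smul_right]
  simp only [← h2]
  have e : 1 / (Real.pi * ħ) * 2⁻¹ = 1 / (2 * Real.pi * ħ) := by
    rw [one_div, one_div, mul_inv, mul_inv, mul_inv]
    ring
  rw [h1, abs_of_pos (by positivity), Complex.real_smul, ← mul_assoc, ← Complex.ofReal_mul,
    ← inv_pow, ← mul_pow, e, crossWigner]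

lemma norm_exp_I_div_mul (ħ t : ℝ) : ‖Complex.exp ((Complex.I / ħ) * (t : ℂ))‖ = 1 := by
  have : (Complex.I / ħ) * (t : ℂ) = ((t / ħ : ℝ) : ℂ) * Complex.I := by
    push_cast
    ring
  rw [this, Complex.norm_exp_ofReal_mul_I]

lemma conj_exp_I_div_mul (ħ t : ℝ) : conj (Complex.exp ((Complex.I / ħ) * (t : ℂ))) =
    Complex.exp (-(Complex.I / ħ) * (t : ℂ)) := by
  rw [← Complex.exp_conj, map_mul, map_div₀, Complex.conj_I, Complex.conj_ofReal,
    Complex.conj_ofReal, neg_div]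

/-- The reflection of `φ` about the phase space point `z`. -/
noncomputable def phaseReflection (ħ : ℝ) (z : PhaseSpace n) (φ : ConfigSpace n → ℂ)
    (u : ConfigSpace n) : ℂ :=
  Complex.exp ((Complex.I / ħ) * ((2 * inner ℝ z.snd (u - z.fst) : ℝ) : ℂ)) *
    φ ((2 : ℝ) • z.fst - u)

lemma memLp_phaseReflection (ħ : ℝ) (z : PhaseSpace n) (φ : L2 (ConfigSpace n)) :
    MemLp (phaseReflection ħ z φ) 2 := by
  have h : MemLp (fun u => φ ((2 : ℝ) • z.fst - u)) 2 :=
    (Lp.memLp φ).comp_measurePreserving (Measure.measurePreserving_sub_left volume _)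
  refine h.of_le (Continuous.aestronglyMeasurable (by fun_prop) |>.mul h.1)
    (ae_of_all _ fun u => ?_)
  rw [phaseReflection, norm_mul, norm_exp_I_div_mul, one_mul]

lemma crossWigner_eq_integral_mul_conj_phaseReflection {ħ : ℝ} (ψ φ : ConfigSpace n → ℂ)
    (z : PhaseSpace n) :
    crossWigner ħ ψ φ z = ((1 / (Real.pi * ħ)) ^ n : ℝ) *
      ∫ u : ConfigSpace n, ψ u * conj (phaseReflection ħ z φ u) := by
  rw [crossWigner_eq_integral_reflect]
  congr 2
  funext u
  rw [phaseReflection, map_mul, conj_exp_I_div_mul]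
  ring

lemma symplecticForm_eq (z z' : PhaseSpace n) :
    symplecticForm z z' = inner ℝ z.snd z'.fst - inner ℝ z'.snd z.fst := by
  rw [symplecticForm, symplecticJ, WithLp.prod_inner_apply]
  change inner ℝ z.snd z'.fst + inner ℝ (-z.fst) z'.snd = _
  rw [inner_neg_left, real_inner_comm z'.snd z.fst, ← sub_eq_add_neg]

/-- Displacing the first argument of `W` amounts to a Bopp displacement of `W`. -/
lemma crossWigner_heisenbergWeyl (ħ : ℝ) (ψ φ : ConfigSpace n → ℂ) (z₀ z : PhaseSpace n) :
    crossWigner ħ (heisenbergWeyl ħ z₀ ψ) φ z =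
      boppDisplacement ħ z₀ (crossWigner ħ ψ φ) z := by
  rw [boppDisplacement, crossWigner, crossWigner, mul_left_comm]
  congr 1
  -- The shift `y ↦ y + x₀` moves the displacement of `ψ` symmetrically onto both arguments, which
  -- become those of `W` at `z - z₀/2`. The remaining phases combine to `σ(z, z₀)`.
  rw [← integral_const_mul, ← integral_add_right_eq_self _ z₀.fst]
  congr 1
  funext y
  have e1 : z.fst + (1 / 2 : ℝ) • (y + z₀.fst) - z₀.fst =
      (z - (1 / 2 : ℝ) • z₀).fst + (1 / 2 : ℝ) • y := by
    rw [WithLp.sub_fst, WithLp.smul_fst]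
    module
  have e2 : z.fst - (1 / 2 : ℝ) • (y + z₀.fst) =
      (z - (1 / 2 : ℝ) • z₀).fst - (1 / 2 : ℝ) • y := by
    rw [WithLp.sub_fst, WithLp.smul_fst]
    module
  rw [heisenbergWeyl, e1, e2, ← mul_assoc, ← mul_assoc, ← mul_assoc, ← mul_assoc,
    ← Complex.exp_add, ← Complex.exp_add]
  congr 3
  rw [symplecticForm_eq]
  simp only [WithLp.sub_snd, WithLp.smul_snd, inner_add_right, inner_sub_left,
    real_inner_smul_left, real_inner_smul_right]
  push_cast
  ring

/-- The wavepacket transforms intertwine Weyl and Bopp operators. -/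
lemma crossWigner_weylOperator {ħ : ℝ} {a : L2 (PhaseSpace n)}
    {A : L2 (ConfigSpace n) →L[ℂ] L2 (ConfigSpace n)} (hA : IsWeylOperator ħ a A)
    (ψ φ : L2 (ConfigSpace n)) (z : PhaseSpace n) :
    crossWigner ħ (A ψ) φ z = boppOperator ħ a (crossWigner ħ ψ φ) z := by
  have hχ := memLp_phaseReflection ħ z φ
  have h1 : ∀ f : ConfigSpace n → ℂ, ∫ u, f u * conj (hχ.toLp _ u) =
      ∫ u, f u * conj (phaseReflection ħ z φ u) := fun f => by
    refine integral_congr_ae ?_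
    filter_upwards [hχ.coeFn_toLp] with u hu
    rw [hu]
  -- For fixed `z` the reflected window is one test vector, so the weak identity gives the value at
  -- `z` directly, with no exchange of integrals.
  have h2 := hA ψ (hχ.toLp _)
  have h3 : inner ℂ (hχ.toLp _) (A ψ) = ∫ u, A ψ u * conj (phaseReflection ħ z φ u) := by
    rw [← h1, L2.inner_def]
    rfl
  rw [h3] at h2
  simp only [h1] at h2
  rw [crossWigner_eq_integral_mul_conj_phaseReflection, h2, boppOperator, mul_left_comm]
  congr 1
  rw [← integral_const_mul]
  congr 1
  funext z₀
  rw [← crossWigner_heisenbergWeyl, crossWigner_eq_integral_mul_conj_phaseReflection,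
    mul_left_comm]

/-- Equality holds at every `z`, because for fixed `z` the preimage of a null set under `z₀ ↦ z -
z₀/2` is null. -/
lemma boppOperator_congr_ae (ħ : ℝ) (a : L2 (PhaseSpace n)) {Ψ Φ : PhaseSpace n → ℂ}
    (h : Ψ =ᵐ[volume] Φ) : boppOperator ħ a Ψ = boppOperator ħ a Φ := by
  funext z
  have hq : Measure.QuasiMeasurePreserving (fun z₀ : PhaseSpace n => z + (-(1 / 2) : ℝ) • z₀)
      volume volume :=
    (measurePreserving_add_left volume z).quasiMeasurePreserving.comp
      (Measure.quasiMeasurePreserving_smul (volume : Measure (PhaseSpace n)) (by norm_num))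
  simp only [neg_smul, ← sub_eq_add_neg] at hq
  rw [boppOperator, boppOperator]
  congr 1
  refine integral_congr_ae ?_
  filter_upwards [hq.ae h] with z₀ hz
  rw [boppDisplacement, boppDisplacement, hz]

lemma boppOperator_const_mul (ħ : ℝ) (a : L2 (PhaseSpace n)) (c : ℂ) (Ψ : PhaseSpace n → ℂ)
    (z : PhaseSpace n) : boppOperator ħ a (fun w => c * Ψ w) z = c * boppOperator ħ a Ψ z := by
  rw [boppOperator, boppOperator, mul_left_comm]
  congr 1
  rw [← integral_const_mul]
  congr 1
  funext z₀
  rw [boppDisplacement, boppDisplacement]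
  ring

/-- `Op_Bopp(a) U_φ = U_φ Op_Weyl(a)`. -/
lemma wavepacket_weylOperator_ae_eq {ħ : ℝ} (hħ : 0 < ħ) {a : L2 (PhaseSpace n)}
    {A : L2 (ConfigSpace n) →L[ℂ] L2 (ConfigSpace n)} (hA : IsWeylOperator ħ a A)
    (φ ψ : L2 (ConfigSpace n)) :
    (wavepacket hħ φ (A ψ) : PhaseSpace n → ℂ) =ᵐ[volume]
      boppOperator ħ a (wavepacket hħ φ ψ) := by
  rw [boppOperator_congr_ae ħ a (wavepacket_coeFn hħ φ ψ)]
  filter_upwards [wavepacket_coeFn hħ φ (A ψ)] with z hz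
  rw [hz, boppOperator_const_mul, crossWigner_weylOperator hA]

/-! ### Density operators and ray projections under unitary conjugation -/

section UnitaryEquivalence

variable {H K : Type} [NormedAddCommGroup H] [InnerProductSpace ℂ H]
  [NormedAddCommGroup K] [InnerProductSpace ℂ K]

/-- Density operators are invariant under unitary equivalence. -/
lemma IsDensityOperator.conj_unitary {T : H →L[ℂ] H} (hT : IsDensityOperator T) (U : H ≃ₗᵢ[ℂ] K) :
    IsDensityOperator (U.toContinuousLinearEquiv.conjContinuousAlgEquiv T) := by
  have happ : ∀ x, U.toContinuousLinearEquiv.conjContinuousAlgEquiv T x = U (T (U.symm x)) :=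
    fun _ => rfl
  have hin : ∀ x y, inner ℂ x (U.toContinuousLinearEquiv.conjContinuousAlgEquiv T y) =
      inner ℂ (U.symm x) (T (U.symm y)) := fun x y => by
    rw [happ, ← LinearIsometryEquiv.inner_map_map U.symm, U.symm_apply_apply]
  have hin' : ∀ x y, inner ℂ (U.toContinuousLinearEquiv.conjContinuousAlgEquiv T x) y =
      inner ℂ (T (U.symm x)) (U.symm y) := fun x y => by
    rw [happ, ← LinearIsometryEquiv.inner_map_map U.symm, U.symm_apply_apply]
  -- Hilbert bases of `K` pull back to Hilbert bases of `H`, so the conditions on all bases of `K`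
  -- reduce to those on `H`.
  have hb : ∀ (ι : Type) (e : HilbertBasis ι ℂ K) (i : ι),
      HilbertBasis.ofRepr (U.trans e.repr) i = U.symm (e i) := fun ι e i => by
    classical
    rw [← HilbertBasis.repr_symm_single, ← HilbertBasis.repr_symm_single]
    rfl
  refine ⟨⟨fun x y => ?_, fun x => ?_⟩, fun ι e => ?_, fun ι e => ?_⟩
  · exact (hin' x y).trans ((hT.isPositive.1 _ _).trans (hin x y).symm)
  · have := hT.isPositive.2 (U.symm x)
    rw [ContinuousLinearMap.reApplyInnerSelf_apply] at this ⊢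
    rwa [hin']
  · simpa only [hin, hb] using hT.isTraceClass ι (HilbertBasis.ofRepr (U.trans e.repr))
  · simpa only [hin, hb] using hT.hasTrace_one ι (HilbertBasis.ofRepr (U.trans e.repr))

/-- The scalar `c` does not alter the line. It absorbs the factor `‖φ‖` between `U_φ` and its
unitary normalization. -/
lemma conj_rayProjection (U : H ≃ₗᵢ[ℂ] K) (v : H) {c : ℂ} (hc : c ≠ 0) :
    U.toContinuousLinearEquiv.conjContinuousAlgEquiv (rayProjection v) =
      rayProjection (c • U v) := by
  have hs : Submodule.span ℂ {c • U v} = Submodule.span ℂ {U v} :=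
    Submodule.span_singleton_smul_eq (IsUnit.mk0 c hc) _
  ext x
  change U (rayProjection v (U.symm x)) = _
  simp only [rayProjection, hs]
  rw [Submodule.starProjection_singleton, Submodule.starProjection_singleton, map_smul,
    LinearIsometryEquiv.norm_map, ← LinearIsometryEquiv.inner_map_map U v, U.apply_symm_apply]

lemma hasSum_conj_rayProjection (U : H ≃ₗᵢ[ℂ] K) {T : H →L[ℂ] H} {ι : Type} {lam : ι → ℝ}
    {ψ : ι → H} (h : HasSum (fun j => (lam j : ℂ) • rayProjection (ψ j)) T) {c : ℂ} (hc : c ≠ 0) :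
    HasSum (fun j => (lam j : ℂ) • rayProjection (c • U (ψ j)))
      (U.toContinuousLinearEquiv.conjContinuousAlgEquiv T) := by
  have h2 := h.map U.toContinuousLinearEquiv.conjContinuousAlgEquiv
    (ContinuousAlgEquiv.continuous _)
  simpa only [Function.comp_def, map_smul, conj_rayProjection U _ hc] using h2

/-- Evaluation at `ψ j` is continuous in operator norm, and orthogonality kills every term except
the `j`-th. -/
lemma rayProjection_sum_apply_of_orthonormal {T : H →L[ℂ] H} {ι : Type} {lam : ι → ℝ} {ψ : ι → H}
    (hs : HasSum (fun j => (lam j : ℂ) • rayProjection (ψ j)) T) (hψ : Orthonormal ℂ ψ) (j : ι) :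
    T (ψ j) = (lam j : ℂ) • ψ j := by
  have h := hs.mapL (ContinuousLinearMap.apply ℂ H (ψ j))
  have hk : ∀ k ≠ j, ContinuousLinearMap.apply ℂ H (ψ j) ((lam k : ℂ) • rayProjection (ψ k)) = 0 :=
    fun k hk => by simp [rayProjection, Submodule.starProjection_singleton, hψ.2 hk]
  rw [← ContinuousLinearMap.apply_apply (ψ j) T, h.unique (hasSum_single j hk),
    ContinuousLinearMap.apply_apply, smul_apply, rayProjection,
    Submodule.starProjection_singleton, inner_self_eq_norm_sq_to_K, hψ.1 j]
  simp

end UnitaryEquivalence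

/-! ### The unitary onto `H_φ` and the restricted Bopp operator -/

section Wavepacket

variable {ħ : ℝ}

lemma norm_wavepacket (hħ : 0 < ħ) (φ ψ : L2 (ConfigSpace n)) :
    ‖wavepacket hħ φ ψ‖ = ‖φ‖ * ‖ψ‖ := by
  have h := inner_wavepacket hħ φ φ ψ ψ
  simp only [inner_self_eq_norm_sq_to_K] at h
  have h2 : ‖wavepacket hħ φ ψ‖ ^ 2 = (‖φ‖ * ‖ψ‖) ^ 2 := by
    rw [mul_pow, mul_comm]
    exact_mod_cast h
  exact (sq_eq_sq₀ (norm_nonneg _) (by positivity)).1 h2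

/-- For `φ ≠ 0`, the isometry `‖φ‖⁻¹ U_φ`. -/
noncomputable def wavepacketIsometry (hħ : 0 < ħ) {φ : L2 (ConfigSpace n)} (hφ : φ ≠ 0) :
    L2 (ConfigSpace n) →ₗᵢ[ℂ] L2 (PhaseSpace n) where
  toLinearMap := (‖φ‖ : ℂ)⁻¹ • wavepacket hħ φ
  norm_map' ψ := by
    rw [LinearMap.smul_apply, norm_smul, norm_wavepacket, norm_inv, Complex.norm_real, norm_norm,
      inv_mul_cancel_left₀ (norm_ne_zero_iff.2 hφ)]

lemma wavepacketIsometry_apply (hħ : 0 < ħ) {φ : L2 (ConfigSpace n)} (hφ : φ ≠ 0)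
    (ψ : L2 (ConfigSpace n)) :
    wavepacketIsometry hħ hφ ψ = (‖φ‖ : ℂ)⁻¹ • wavepacket hħ φ ψ := rfl

lemma wavepacketIsometry_mem (hħ : 0 < ħ) {φ : L2 (ConfigSpace n)} (hφ : φ ≠ 0)
    (ψ : L2 (ConfigSpace n)) : wavepacketIsometry hħ hφ ψ ∈ windowSpace hħ φ :=
  (windowSpace hħ φ).smul_mem _ (LinearMap.mem_range_self _ ψ)

/-- For `φ ≠ 0`, the unitary `‖φ‖⁻¹ U_φ` of `L²(ℝⁿ)` onto `H_φ`. -/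
noncomputable def wavepacketUnitary (hħ : 0 < ħ) {φ : L2 (ConfigSpace n)} (hφ : φ ≠ 0) :
    L2 (ConfigSpace n) ≃ₗᵢ[ℂ] windowSpace hħ φ :=
  LinearIsometryEquiv.ofSurjective
    { toLinearMap := (wavepacketIsometry hħ hφ).toLinearMap.codRestrict (windowSpace hħ φ)
        (wavepacketIsometry_mem hħ hφ)
      norm_map' := (wavepacketIsometry hħ hφ).norm_map }
    (by
      have : (‖φ‖ : ℂ) ≠ 0 := Complex.ofReal_ne_zero.2 (norm_ne_zero_iff.2 hφ)
      rintro ⟨_, ψ, rfl⟩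
      refine ⟨(‖φ‖ : ℂ) • ψ, Subtype.ext ?_⟩
      change wavepacketIsometry hħ hφ ((‖φ‖ : ℂ) • ψ) = wavepacket hħ φ ψ
      rw [map_smul, wavepacketIsometry_apply, smul_inv_smul₀ this])

lemma smul_wavepacketUnitary (hħ : 0 < ħ) {φ : L2 (ConfigSpace n)} (hφ : φ ≠ 0)
    (ψ : L2 (ConfigSpace n)) :
    (‖φ‖ : ℂ) • wavepacketUnitary hħ hφ ψ = wavepacketIn hħ φ ψ := by
  have : (‖φ‖ : ℂ) ≠ 0 := Complex.ofReal_ne_zero.2 (norm_ne_zero_iff.2 hφ)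
  refine Subtype.ext ?_
  change (‖φ‖ : ℂ) • wavepacketIsometry hħ hφ ψ = wavepacket hħ φ ψ
  rw [wavepacketIsometry_apply, smul_inv_smul₀ this]

lemma isClosed_windowSpace (hħ : 0 < ħ) {φ : L2 (ConfigSpace n)} (hφ : φ ≠ 0) :
    IsClosed (windowSpace hħ φ : Set (L2 (PhaseSpace n))) := by
  have : CompleteSpace (windowSpace hħ φ) :=
    ((wavepacketUnitary hħ hφ).isometry.isUniformInducing.completeSpace_congr
      (wavepacketUnitary hħ hφ).surjective).1 inferInstance
  exact (completeSpace_coe_iff_isComplete.1 this).isClosed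

/-- The operator on `H_φ` that is unitarily equivalent to `A` through `U_φ`. -/
noncomputable def windowOperator (hħ : 0 < ħ) {φ : L2 (ConfigSpace n)} (hφ : φ ≠ 0)
    (A : L2 (ConfigSpace n) →L[ℂ] L2 (ConfigSpace n)) : windowSpace hħ φ →L[ℂ] windowSpace hħ φ :=
  (wavepacketUnitary hħ hφ).toContinuousLinearEquiv.conjContinuousAlgEquiv A

lemma windowOperator_wavepacketIn (hħ : 0 < ħ) {φ : L2 (ConfigSpace n)} (hφ : φ ≠ 0)
    (A : L2 (ConfigSpace n) →L[ℂ] L2 (ConfigSpace n)) (ψ : L2 (ConfigSpace n)) :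
    windowOperator hħ hφ A (wavepacketIn hħ φ ψ) = wavepacketIn hħ φ (A ψ) := by
  rw [← smul_wavepacketUnitary hħ hφ, ← smul_wavepacketUnitary hħ hφ, map_smul]
  congr 1
  change wavepacketUnitary hħ hφ (A ((wavepacketUnitary hħ hφ).symm _)) = _
  rw [LinearIsometryEquiv.symm_apply_apply]

/-- `windowOperator` is the restriction of the Bopp operator. -/
lemma windowOperator_ae_eq_boppOperator (hħ : 0 < ħ) {φ : L2 (ConfigSpace n)} (hφ : φ ≠ 0)
    {a : L2 (PhaseSpace n)} {A : L2 (ConfigSpace n) →L[ℂ] L2 (ConfigSpace n)}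
    (hA : IsWeylOperator ħ a A) (Ψ : windowSpace hħ φ) :
    ((windowOperator hħ hφ A Ψ : L2 (PhaseSpace n)) : PhaseSpace n → ℂ) =ᵐ[volume]
      boppOperator ħ a (Ψ : L2 (PhaseSpace n)) := by
  obtain ⟨Ψ, ψ, rfl⟩ := Ψ
  have := windowOperator_wavepacketIn hħ hφ A ψ
  rw [wavepacketIn] at this
  rw [this]
  exact wavepacket_weylOperator_ae_eq hħ hA φ ψ

lemma hasSum_windowOperator (hħ : 0 < ħ) {φ : L2 (ConfigSpace n)} (hφ : φ ≠ 0)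
    {A : L2 (ConfigSpace n) →L[ℂ] L2 (ConfigSpace n)} {ι : Type} {lam : ι → ℝ}
    {ψ : ι → L2 (ConfigSpace n)} (h : HasSum (fun j => (lam j : ℂ) • rayProjection (ψ j)) A) :
    HasSum (fun j => (lam j : ℂ) • rayProjection (wavepacketIn hħ φ (ψ j)))
      (windowOperator hħ hφ A) := by
  have h2 := hasSum_conj_rayProjection (wavepacketUnitary hħ hφ) h
    (Complex.ofReal_ne_zero.2 (norm_ne_zero_iff.2 hφ))
  simpa only [smul_wavepacketUnitary] using! h2

end Wavepacket

/-! ### Existence of a square integrable Weyl symbol -/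

/-- A positive operator of trace class is a Hilbert–Schmidt operator. -/
lemma summable_norm_sq_apply_of_isTraceClass {H : Type} [NormedAddCommGroup H]
    [InnerProductSpace ℂ H] [CompleteSpace H] {T : H →L[ℂ] H} (hT : T.IsPositive)
    (hT' : IsTraceClass T) {ι : Type} (e : HilbertBasis ι ℂ H) :
    Summable fun i => ‖T (e i)‖ ^ 2 := by
  have h0 : 0 ≤ T := (ContinuousLinearMap.nonneg_iff_isPositive T).2 hT
  -- With `S = √T`, `‖T e‖² ≤ ‖S‖² ‖S e‖² = ‖S‖² ⟨e, T e⟩`, and the diagonal is summable.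
  set S : H →L[ℂ] H := CFC.sqrt T
  have hS : S * S = T := CFC.sqrt_mul_sqrt_self T h0
  have hSs : (S : H →ₗ[ℂ] H).IsSymmetric :=
    ((ContinuousLinearMap.nonneg_iff_isPositive S).1 (CFC.sqrt_nonneg T)).1
  have hSx : ∀ x, ‖S x‖ ^ 2 = ‖inner ℂ x (T x)‖ := fun x => by
    have h : inner ℂ (S x) (S x) = inner ℂ x (S (S x)) := hSs x (S x)
    rw [← hS, mul_apply_eq_comp, ← h, inner_self_eq_norm_sq_to_K, norm_pow]
    simp
  refine ((hT' ι e).mul_left (‖S‖ ^ 2)).of_nonneg_of_le (fun _ => by positivity) fun i => ?_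
  rw [← hSx, ← mul_pow]
  refine pow_le_pow_left₀ (norm_nonneg _) ?_ 2
  rw [← hS]
  exact S.le_opNorm _

/-- `symplecticJ` as an isometry of the phase space. -/
noncomputable def symplecticJIsometry (n : ℕ) : PhaseSpace n ≃ₗᵢ[ℝ] PhaseSpace n where
  toFun := symplecticJ
  invFun z := -symplecticJ z
  map_add' z w := by
    apply (WithLp.equiv 2 _).injective
    refine Prod.ext rfl ?_
    change -(z.fst + w.fst) = -z.fst + -w.fst
    abel
  map_smul' c z := by
    apply (WithLp.equiv 2 _).injective
    refine Prod.ext rfl ?_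
    change -(c • z.fst) = c • -z.fst
    rw [smul_neg]
  left_inv z := by
    apply (WithLp.equiv 2 _).injective
    exact Prod.ext (neg_neg z.fst) (neg_neg z.snd)
  right_inv z := by
    apply (WithLp.equiv 2 _).injective
    refine Prod.ext (neg_neg z.fst) (neg_neg z.snd)
  norm_map' z := by
    change ‖symplecticJ z‖ = ‖z‖
    rw [WithLp.prod_norm_eq_of_L2, WithLp.prod_norm_eq_of_L2, symplecticJ]
    change √(‖z.snd‖ ^ 2 + ‖-z.fst‖ ^ 2) = _
    rw [norm_neg, add_comm]

lemma symplecticJ_symplecticJ (z : PhaseSpace n) : symplecticJ (symplecticJ z) = -z := by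
  rw [eq_comm, neg_eq_iff_eq_neg]
  exact ((symplecticJIsometry n).left_inv z).symm

lemma symplecticJ_smul (r : ℝ) (z : PhaseSpace n) : symplecticJ (r • z) = r • symplecticJ z :=
  (symplecticJIsometry n).map_smul r z

lemma memLp_comp_smul_symplecticJ {F : PhaseSpace n → ℂ} (hF : MemLp F 2) {r : ℝ} (hr : r ≠ 0) :
    MemLp (fun w => F (r • symplecticJ w)) 2 := by
  have h1 : MemLp F 2 (Measure.map (r • ·) (volume : Measure (PhaseSpace n))) := by
    rw [Measure.map_addHaar_smul _ hr]
    exact hF.smul_measure ENNReal.ofReal_ne_top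
  have h2 : MemLp (fun w => F (r • w)) 2 :=
    (memLp_map_measure_iff h1.1 (by fun_prop)).1 h1
  exact h2.comp_measurePreserving (symplecticJIsometry n).measurePreserving

/-- Every multiple of a dilation of an `L²` function is a symplectic Fourier transform. -/
lemma exists_symplecticFourier_ae_eq {ħ : ℝ} (hħ : 0 < ħ) (F : L2 (PhaseSpace n)) (c : ℂ) :
    ∃ a : L2 (PhaseSpace n), symplecticFourier ħ a =ᵐ[volume]
      fun z => c * F ((1 / 2 : ℝ) • z) := by
  have hh : 2 * Real.pi * ħ ≠ 0 := by positivity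
  set k : ℂ := (((1 / (2 * Real.pi * ħ)) ^ n : ℝ) : ℂ) with hk
  have hk0 : k ≠ 0 := Complex.ofReal_ne_zero.2 (pow_ne_zero _ (one_div_ne_zero hh))
  -- At the frequency `(2πħ)⁻¹ J z` the factor `2πħ` cancels, and the sign in `-(1/2)` compensates
  -- `J² = -1`, leaving `F (z/2)`.
  have hG := (memLp_comp_smul_symplecticJ (Lp.memLp F) (r := -(1 / 2) * (2 * Real.pi * ħ))
    (mul_ne_zero (by norm_num) hh)).const_mul (k⁻¹ * c)
  refine ⟨𝓕⁻ (hG.toLp _), ?_⟩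
  have hq : Measure.QuasiMeasurePreserving
      (fun z : PhaseSpace n => (2 * Real.pi * ħ)⁻¹ • symplecticJ z) volume volume :=
    (Measure.quasiMeasurePreserving_smul (volume : Measure (PhaseSpace n)) (inv_ne_zero hh)).comp
      (symplecticJIsometry n).measurePreserving.quasiMeasurePreserving
  filter_upwards [hq.ae hG.coeFn_toLp] with z hz
  rw [symplecticFourier, fourier_fourierInv_eq, hz, ← hk, symplecticJ_smul,
    symplecticJ_symplecticJ, ← mul_assoc, mul_inv_cancel_left₀ hk0, smul_smul,
    mul_assoc (-(1 / 2) : ℝ), mul_inv_cancel₀ hh, mul_one, smul_neg, neg_smul, neg_neg]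

/-- The displacement by `z` is parity followed by the reflection about `z/2`, so its matrix elements
are conjugated Wigner functions at `z/2`. -/
lemma integral_heisenbergWeyl_mul_conj {ħ : ℝ} (hħ : 0 < ħ) (ψ χ : ConfigSpace n → ℂ)
    (z : PhaseSpace n) :
    ∫ x, heisenbergWeyl ħ z ψ x * conj (χ x) = ((Real.pi * ħ) ^ n : ℝ) *
      conj (crossWigner ħ χ (fun x => ψ (-x)) ((1 / 2 : ℝ) • z)) := by
  have hh : Real.pi * ħ ≠ 0 := by positivity
  rw [crossWigner_eq_integral_reflect, map_mul, Complex.conj_ofReal, ← mul_assoc,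
    ← Complex.ofReal_mul, ← mul_pow, mul_one_div_cancel hh, one_pow, Complex.ofReal_one, one_mul,
    ← integral_conj]
  congr 1
  funext x
  have e1 : -((2 : ℝ) • ((1 / 2 : ℝ) • z).fst - x) = x - z.fst := by
    rw [WithLp.smul_fst]
    module
  rw [e1, map_mul, map_mul, Complex.conj_conj, ← conj_exp_I_div_mul, Complex.conj_conj,
    heisenbergWeyl]
  have e2 : (inner ℝ z.snd x - (1 / 2) * inner ℝ z.snd z.fst : ℝ) =
      2 * inner ℝ ((1 / 2 : ℝ) • z).snd (x - ((1 / 2 : ℝ) • z).fst) := by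
    rw [WithLp.smul_fst, WithLp.smul_snd, inner_sub_right, real_inner_smul_left,
      real_inner_smul_left, real_inner_smul_right]
    ring
  rw [e2]
  ring

lemma integral_comp_half_smul_phaseSpace (G : PhaseSpace n → ℂ) :
    ∫ z, G ((1 / 2 : ℝ) • z) = (4 : ℂ) ^ n * ∫ z, G z := by
  have : Module.finrank ℝ (PhaseSpace n) = n + n := by
    rw [LinearEquiv.finrank_eq (WithLp.linearEquiv 2 ℝ (ConfigSpace n × ConfigSpace n)),
      Module.finrank_prod, finrank_euclideanSpace, Fintype.card_fin]
  rw [Measure.integral_comp_smul, this, abs_of_pos (by positivity), Complex.real_smul]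
  congr 1
  rw [pow_add, ← mul_pow, ← inv_pow]
  norm_num

/-- Reflection `ψ ↦ ψ(-·)` on `L²(ℝⁿ)`. -/
noncomputable def parity (n : ℕ) : L2 (ConfigSpace n) →ₗᵢ[ℂ] L2 (ConfigSpace n) :=
  Lp.compMeasurePreservingₗᵢ ℂ (fun x => -x) (Measure.measurePreserving_neg volume)

lemma parity_coeFn (ψ : L2 (ConfigSpace n)) : parity n ψ =ᵐ[volume] fun x => ψ (-x) :=
  Lp.coeFn_compMeasurePreserving ψ (Measure.measurePreserving_neg volume)

lemma crossWigner_congr_right (ħ : ℝ) (ψ : ConfigSpace n → ℂ) {φ φ' : ConfigSpace n → ℂ}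
    (h : φ =ᵐ[volume] φ') : crossWigner ħ ψ φ = crossWigner ħ ψ φ' := by
  funext z
  rw [crossWigner_eq_integral_reflect, crossWigner_eq_integral_reflect]
  congr 1
  refine integral_congr_ae ?_
  filter_upwards [(Measure.measurePreserving_sub_left volume
    ((2 : ℝ) • z.fst)).quasiMeasurePreserving.ae h] with u hu
  rw [hu]

/-- An operator whose matrix elements are scalar products of a fixed `F ∈ L²(ℝ²ⁿ)` with wavepacket
transforms has a Weyl symbol. -/
lemma exists_isWeylOperator_of_inner_eq {ħ : ℝ} (hħ : 0 < ħ)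
    {A : L2 (ConfigSpace n) →L[ℂ] L2 (ConfigSpace n)} {F : L2 (PhaseSpace n)}
    (hF : ∀ ψ χ, inner ℂ χ (A ψ) = inner ℂ (wavepacket hħ (parity n ψ) χ) F) :
    ∃ a : L2 (PhaseSpace n), IsWeylOperator ħ a A := by
  have hh : 0 < 2 * Real.pi * ħ := by positivity
  set s : ℝ := (2 * Real.pi * ħ) ^ ((n : ℝ) / 2) with hs
  -- The constant solves `(2πħ)⁻ⁿ · 4ⁿ · c · (πħ)ⁿ = s`: `4ⁿ` is the Jacobian of `z ↦ z/2` in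
  -- dimension `2n`, `(πħ)ⁿ` comes from the matrix element of `T̂(z)`, and `s` normalizes `U`.
  obtain ⟨a, ha⟩ := exists_symplecticFourier_ae_eq hħ F ((s / 2 ^ n : ℝ) : ℂ)
  refine ⟨a, fun ψ χ => ?_⟩
  have h1 : ∫ z : PhaseSpace n, symplecticFourier ħ a z *
        ∫ x : ConfigSpace n, heisenbergWeyl ħ z ψ x * conj (χ x) =
      (4 : ℂ) ^ n * ∫ w : PhaseSpace n, ((s / 2 ^ n * (Real.pi * ħ) ^ n : ℝ) : ℂ) *
        (F w * conj (crossWigner ħ χ (parity n ψ) w)) := by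
    refine Eq.trans ?_ (integral_comp_half_smul_phaseSpace _)
    refine integral_congr_ae ?_
    filter_upwards [ha] with z hz
    rw [hz, integral_heisenbergWeyl_mul_conj hħ, crossWigner_congr_right ħ χ (parity_coeFn ψ)]
    push_cast
    ring
  rw [h1, integral_const_mul, hF, L2.inner_def]
  have h2 : ∫ z, inner ℂ (wavepacket hħ (parity n ψ) χ z) (F z) =
      (s : ℂ) * ∫ z, F z * conj (crossWigner ħ χ (parity n ψ) z) := by
    rw [← integral_const_mul]
    refine integral_congr_ae ?_
    filter_upwards [wavepacket_coeFn hħ (parity n ψ) χ] with z hz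
    rw [hz, RCLike.inner_apply, map_mul, Complex.conj_ofReal]
    ring
  rw [h2, ← mul_assoc, ← mul_assoc]
  congr 1
  have e : (1 / (2 * Real.pi * ħ)) ^ n * 4 ^ n * (s / 2 ^ n * (Real.pi * ħ) ^ n) = s := by
    have : (1 / (2 * Real.pi * ħ)) ^ n * 4 ^ n * ((2 ^ n)⁻¹ * (Real.pi * ħ) ^ n) = 1 := by
      rw [← inv_pow, ← mul_pow, ← mul_pow, ← mul_pow]
      have : 1 / (2 * Real.pi * ħ) * 4 * (2⁻¹ * (Real.pi * ħ)) = 1 := by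
        field_simp
        norm_num
      rw [this, one_pow]
    rw [div_eq_mul_inv s, mul_assoc s, mul_left_comm, this, mul_one]
  exact_mod_cast e.symm

/-- Positive operators of trace class have a Weyl symbol in `L²`. -/
lemma exists_isWeylOperator {ħ : ℝ} (hħ : 0 < ħ)
    {A : L2 (ConfigSpace n) →L[ℂ] L2 (ConfigSpace n)} (hA : A.IsPositive) (hA' : IsTraceClass A) :
    ∃ a : L2 (PhaseSpace n), IsWeylOperator ħ a A := by
  obtain ⟨w, e, -⟩ := exists_hilbertBasis ℂ (L2 (ConfigSpace n))
  have hnorm : ∀ i, ‖parity n (e i)‖ = 1 := fun i => by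
    rw [LinearIsometry.norm_map, e.orthonormal.1]
  have hne : ∀ i, parity n (e i) ≠ 0 := fun i => by
    rw [← norm_ne_zero_iff, hnorm]
    exact one_ne_zero
  have hW : ∀ i ψ, wavepacketIsometry hħ (hne i) ψ = wavepacket hħ (parity n (e i)) ψ :=
    fun i ψ => by rw [wavepacketIsometry_apply, hnorm, Complex.ofReal_one, inv_one, one_smul]
  -- By Moyal's identity, orthogonal windows have orthogonal wavepacket ranges. Convergence of the
  -- series for `F` thus reduces to the Hilbert–Schmidt bound.
  have hO : OrthogonalFamily ℂ (fun _ : w => L2 (ConfigSpace n))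
      (fun i => wavepacketIsometry hħ (hne i)) := by
    intro i j hij ψ χ
    rw [hW, hW, inner_wavepacket, LinearIsometry.inner_map_map, e.orthonormal.2 hij.symm, mul_zero]
  have hS := (hO.summable_iff_norm_sq_summable fun i => A (e i)).2
    (summable_norm_sq_apply_of_isTraceClass hA hA' e)
  refine exists_isWeylOperator_of_inner_eq hħ (F := ∑' i, wavepacketIsometry hħ (hne i) (A (e i)))
    fun ψ χ => ?_
  have h1 := hS.hasSum.mapL (innerSL ℂ (wavepacket hħ (parity n ψ) χ))
  have h2 := (e.hasSum_repr ψ).mapL ((innerSL ℂ χ).comp A)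
  -- The expansion of `(Aψ|χ)` along the basis and the pairing of `F` with `U_{Pψ} χ` agree term by
  -- term.
  have h3 : ∀ i, (innerSL ℂ χ).comp A (e.repr ψ i • e i) =
      innerSL ℂ (wavepacket hħ (parity n ψ) χ) (wavepacketIsometry hħ (hne i) (A (e i))) :=
    fun i => by
      rw [hW, innerSL_apply_apply, inner_wavepacket, LinearIsometry.inner_map_map,
        ContinuousLinearMap.comp_apply, map_smul, innerSL_apply_apply, inner_smul_right,
        e.repr_apply_apply, mul_comm]
  simp only [h3] at h2
  exact h2.unique h1

end BoppQuantization

open BoppQuantization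
theorem mainTheorem1 (n : ℕ) (ħ : ℝ) (hħ : 0 < ħ)
    (ρhat : L2 (ConfigSpace n) →L[ℂ] L2 (ConfigSpace n)) (hρhat : IsDensityOperator ρhat) :
    (∃ ρ : L2 (PhaseSpace n), IsWeylOperator ħ (((2 * Real.pi * ħ : ℝ) : ℂ) ^ n • ρ) ρhat) ∧
    ∀ ρ : L2 (PhaseSpace n), IsWeylOperator ħ (((2 * Real.pi * ħ : ℝ) : ℂ) ^ n • ρ) ρhat →
      ∀ φ : L2 (ConfigSpace n), φ ≠ 0 →
        IsClosed (windowSpace hħ φ : Set (L2 (PhaseSpace n))) ∧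
        ∃ ρφ : windowSpace hħ φ →L[ℂ] windowSpace hħ φ,
          (∀ Ψ : windowSpace hħ φ,
            ((ρφ Ψ : L2 (PhaseSpace n)) : PhaseSpace n → ℂ) =ᵐ[volume]
              boppOperator ħ (((2 * Real.pi * ħ : ℝ) : ℂ) ^ n • ρ) (Ψ : L2 (PhaseSpace n))) ∧
          IsDensityOperator ρφ ∧
          ∀ (ι : Type) (lam : ι → ℝ) (ψ : ι → L2 (ConfigSpace n)),
            HasSum (fun j => (lam j : ℂ) • rayProjection (ψ j)) ρhat →
              HasSum (fun j => (lam j : ℂ) • rayProjection (wavepacketIn hħ φ (ψ j))) ρφ ∧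
              (Orthonormal ℂ ψ →
                ∀ j, ρφ (wavepacketIn hħ φ (ψ j)) = (lam j : ℂ) • wavepacketIn hħ φ (ψ j)) := by
  have hc : ((2 * Real.pi * ħ : ℝ) : ℂ) ^ n ≠ 0 :=
    pow_ne_zero _ (Complex.ofReal_ne_zero.2 (by positivity))
  refine ⟨?_, fun ρ hρ φ hφ => ⟨isClosed_windowSpace hħ hφ, windowOperator hħ hφ ρhat,
    windowOperator_ae_eq_boppOperator hħ hφ hρ, hρhat.conj_unitary _, fun ι lam ψ hψ =>
      ⟨hasSum_windowOperator hħ hφ hψ, fun ho j => ?_⟩⟩⟩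
  · obtain ⟨a, ha⟩ := exists_isWeylOperator hħ hρhat.isPositive hρhat.isTraceClass
    exact ⟨(((2 * Real.pi * ħ : ℝ) : ℂ) ^ n)⁻¹ • a, by rwa [smul_inv_smul₀ hc]⟩
  · rw [windowOperator_wavepacketIn, rayProjection_sum_apply_of_orthonormal hψ ho]
    exact Subtype.ext (map_smul (wavepacket hħ φ) _ _)
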